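/- Fix $\lambda\in(0,1)$ and $d\in(0,1-\lambda)$. For real $a,z$ let $\theta_a(z)=0$ if $z<a$ and $\theta_a(z)=1$ if $z\ge a$; $\lfloor x\rfloor$ and $\{x\}$ denote the integer and the fractional part of $x$. For $\delta,a\in\mathbb R$ let $$F(x)=\lambda x+\delta+(1-\lambda)\lfloor x\rfloor+d\,\theta_a(\{x\})\quad(x\in\mathbb R),\qquad f=f_{\delta,a}:[0,1)\to[0,1),\quad f(x)=\{F(x)\},$$ and $\Lambda=\bigcap_{n\in\mathbb N}f^n([0,1))$. Let $R_\rho(y)=\{y+\rho\}$ for $y\in[0,1)$, and put $$\delta(\rho,\alpha)=1-\lambda-d+\frac{1-\lambda}{\lambda}\sum_{k\ge1}\lambda^k\big((1-\lambda)\lfloor k\rho\rfloor+d\,\theta_{1-\alpha}(\{k\rho\})\big),$$ $$\phi_{\delta,\rho,\alpha}(y)=\frac{\delta}{1-\lambda}+\frac1\lambda\sum_{k\ge1}\lambda^k\big((1-\lambda)\lfloor y-k\rho\rfloor+d\,\theta_\alpha(\{y-k\rho\})\big),\qquad a(\delta,\rho,\alpha)=\phi_{\delta,\rho,\alpha}(\alpha),$$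 $\delta(\rho^-,\alpha)=\lim_{r\to\rho^-}\delta(r,\alpha)$ and $a(\delta,\rho^+,\alpha)=\lim_{r\to\rho^+}a(\delta,r,\alpha)$. A topological semi-conjugacy from $f|_S$ (where $f(S)\subset S$) to $R_\rho$ is a continuous surjection $h:S\to[0,1)$ with $h\circ f|_S=R_\rho\circ h$. The circle topology on $[0,1)$ is the one obtained by identifying $[0,1)$ with $\mathbb R/\mathbb Z$. Let $\rho\in(0,1)\setminus\mathbb Q$, $\alpha\in[0,1]$, and suppose that $$\delta\in[\delta(\rho^-,\alpha),\delta(\rho,\alpha)]\quad\text{and}\quad a\in[a(\delta,\rho^+,\alpha),a(\delta,\rho,\alpha)].$$ Write $\phi=\phi_{\delta,\rho,\alpha}$ and $\phi(1^-)=\lim_{y\to1^-}\phi(y)$. 1. One has $\Lambda\subset[\phi(0),\phi(1^-))\subset[0,1)$. The function $\tilde\varphi:[\phi(0),\phi(1^-))\to[0,1)$, $\tilde\varphi(x)=\inf\{y\in[0,1):\phi(y)\ge x\}$, is well defined and is continuous both for the euclidean topology and for the circle topology (taken on the domain and on the target). Its restriction $\varphi=\tilde\varphi|_\Lambda:\Lambda\to[0,1)$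 is a topological semi-conjugacy from $f|_\Lambda$ to $R_\rho$, for either topology. 2. Let $D=\{k\in\mathbb Z\setminus\{0\}:k\rho\in\mathbb Z+\alpha\}$. Suppose that $a\ne a(\delta,\rho^+,\alpha)$ if $D$ contains a positive integer, and that $\delta\ne\delta(\rho,\alpha)$ if $D$ contains a negative integer. Endow $[0,1)$ with the circle topology and let $\overline\Lambda$ be the closure of $\Lambda$ in it. Then $f(\overline\Lambda)\subset\overline\Lambda$, and $\varphi$ extends to a topological semi-conjugacy $\bar\varphi:\overline\Lambda\to[0,1)$ from $f|_{\overline\Lambda}$ to $R_\rho$. -/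

import Mathlib

open Set Filter Topology

noncomputable section

/-- The phase space `[0,1)`. As a subtype of `ℝ` it carries the euclidean topology by default. -/
abbrev UnitIco : Type := Set.Ico (0 : ℝ) 1

/-- The circle topology on `[0,1)`: the one for which `[0,1) → ℝ/ℤ` is a homeomorphism
(that map is a bijection, so the induced topology is the transported one). -/
@[reducible] def circleTopology : TopologicalSpace UnitIco :=
  TopologicalSpace.induced (fun x : UnitIco => ((x : ℝ) : UnitAddCircle)) inferInstance

/-- The step function `θ_a`. -/
def stepFun (a z : ℝ) : ℝ := if z < a then 0 else 1

/-- The lift `F(x) = λ x + δ + (1-λ)⌊x⌋ + d θ_a({x})`. -/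
def liftF (lam d δ a x : ℝ) : ℝ :=
  lam * x + δ + (1 - lam) * (⌊x⌋ : ℝ) + d * stepFun a (Int.fract x)

/-- The map `f_{δ,a} : [0,1) → [0,1)`, `f(x) = F(x) mod 1`. -/
def mapF (lam d δ a : ℝ) (x : UnitIco) : UnitIco :=
  ⟨Int.fract (liftF lam d δ a x), Int.fract_nonneg _, Int.fract_lt_one _⟩

/-- The rotation `R_ρ(y) = {y + ρ}` of `[0,1)`. -/
def circleRot (ρ : ℝ) (y : UnitIco) : UnitIco :=
  ⟨Int.fract ((y : ℝ) + ρ), Int.fract_nonneg _, Int.fract_lt_one _⟩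

/-- The attractor `Λ = ⋂_{n ∈ ℕ} f^n([0,1))`. -/
def attractor (lam d δ a : ℝ) : Set UnitIco :=
  ⋂ n : ℕ, (mapF lam d δ a)^[n] '' Set.univ

/-- `ψ_α(z) = (1-λ)⌊z⌋ + d θ_α({z})`. -/
def psiFun (lam d α z : ℝ) : ℝ :=
  (1 - lam) * (⌊z⌋ : ℝ) + d * stepFun α (Int.fract z)

/-- `φ_{δ,ρ,α}(y) = δ/(1-λ) + (1/λ) ∑_{k ≥ 1} λ^k ψ_α(y - kρ)`. -/
def phiFun (lam d δ ρ α y : ℝ) : ℝ :=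
  δ / (1 - lam) +
    1 / lam * ∑' k : ℕ, lam ^ (k + 1) * psiFun lam d α (y - ((k + 1 : ℕ) : ℝ) * ρ)

/-- `δ(ρ,α) = 1-λ-d + ((1-λ)/λ) ∑_{k ≥ 1} λ^k ((1-λ)⌊kρ⌋ + d θ_{1-α}({kρ}))`. -/
def deltaFun (lam d ρ α : ℝ) : ℝ :=
  1 - lam - d +
    (1 - lam) / lam * ∑' k : ℕ, lam ^ (k + 1) *
      ((1 - lam) * (⌊((k + 1 : ℕ) : ℝ) * ρ⌋ : ℝ)
        + d * stepFun (1 - α) (Int.fract (((k + 1 : ℕ) : ℝ) * ρ)))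

/-- `a(δ,ρ,α) = δ/(1-λ) + (1/λ) ∑_{k ≥ 1} λ^k ((1-λ)⌊α-kρ⌋ + d θ_α({α-kρ}))`. -/
def aFun (lam d δ ρ α : ℝ) : ℝ :=
  δ / (1 - lam) +
    1 / lam * ∑' k : ℕ, lam ^ (k + 1) *
      ((1 - lam) * (⌊α - ((k + 1 : ℕ) : ℝ) * ρ⌋ : ℝ)
        + d * stepFun α (Int.fract (α - ((k + 1 : ℕ) : ℝ) * ρ)))

/-- The left-sided limit `δ(ρ⁻,α) = lim_{r → ρ⁻} δ(r,α)`. -/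
def deltaLeft (lam d ρ α : ℝ) : ℝ :=
  Function.leftLim (fun r => deltaFun lam d r α) ρ

/-- The right-sided limit `a(δ,ρ⁺,α) = lim_{r → ρ⁺} a(δ,r,α)`. -/
def aRight (lam d δ ρ α : ℝ) : ℝ :=
  Function.rightLim (fun r => aFun lam d δ r α) ρ

/-- The set `D = {k ∈ ℤ, k ≠ 0 : kρ ∈ ℤ + α}`. -/
def resonances (ρ α : ℝ) : Set ℤ :=
  {k | k ≠ 0 ∧ ∃ m : ℤ, (k : ℝ) * ρ = (m : ℝ) + α}

theorem sInf_Ico_mem (p : ℝ → Prop) :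
    sInf {y : ℝ | y ∈ Set.Ico (0 : ℝ) 1 ∧ p y} ∈ Set.Ico (0 : ℝ) 1 := by
  refine ⟨Real.sInf_nonneg fun y hy => hy.1.1, ?_⟩
  rcases Set.eq_empty_or_nonempty {y : ℝ | y ∈ Set.Ico (0 : ℝ) 1 ∧ p y} with h | ⟨y, hy⟩
  · rw [h, Real.sInf_empty]; exact one_pos
  · exact lt_of_le_of_lt (csInf_le ⟨0, fun z hz => hz.1.1⟩ hy) hy.1.2

/-- The generalized inverse `x ↦ inf {y ∈ [0,1) : φ(y) ≥ x}` of `φ`. It is meaningful on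
`invDomain φ` only. -/
def genInv (φ : ℝ → ℝ) (x : UnitIco) : UnitIco :=
  ⟨sInf {y : ℝ | y ∈ Set.Ico (0 : ℝ) 1 ∧ (x : ℝ) ≤ φ y}, sInf_Ico_mem fun y => (x : ℝ) ≤ φ y⟩

/-- The interval `[φ(0), φ(1⁻))`, as a subset of `[0,1)`. -/
def invDomain (φ : ℝ → ℝ) : Set UnitIco :=
  {x | (x : ℝ) ∈ Set.Ico (φ 0) (Function.leftLim φ 1)}

/-- `h` restricted to `S` is a topological semi-conjugacy from `f|_S : S → S` to `g : Y → Y`, for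
the topologies `tX` (of which `S` receives the subspace topology) and `tY`: the set `S` is
`f`-invariant and `h|_S : S → Y` is continuous, onto, and satisfies `h ∘ f = g ∘ h` on `S`. -/
structure IsTopSemiconjOn {X Y : Type*} (tX : TopologicalSpace X) (tY : TopologicalSpace Y)
    (S : Set X) (f : X → X) (g : Y → Y) (h : X → Y) : Prop where
  mapsTo : Set.MapsTo f S S
  continuousOn : @ContinuousOn X Y tX tY h S
  surjOn : Set.SurjOn h S Set.univ
  semiconj : ∀ x ∈ S, h (f x) = g (h x)

end

open Set Filter Topology

noncomputable section

/-! Extend everything to the line. For irrational ρ, φ is strictly increasing and right-continuous,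
commutes with integer translations, and satisfies φ(y+ρ) = λφ(y) + δ + ψ_α(y) (`phiFun_strictMono`,
`phiFun_add_rot`). Its generalized inverse η = `lowerInv φ` is its lower adjoint, η(x) ≤ y ↔ x ≤
φ(y), and is continuous. The interval for δ says φ(0⁻) ≤ 0 ≤ φ(0), that is η(0) = 0; the interval
for a says φ(α⁻) ≤ a ≤ φ(α), that is η(a) = α. Hence φ respects the thresholds of both step
functions, so ψ_a(φ(y)) = ψ_α(y) and F(φ(y)) = φ(y+ρ) (`isLiftConj_phiFun`). By adjunction η(F(x)) =
η(x) + ρ, which is the semi-conjugacy modulo one.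

The attractor is the set of x with φ(η(x)) = x (`mem_attractor_iff`): η carries backward orbits to
backward rotation orbits, which eventually avoid the jumps of φ, and the identity propagates
forward. Taking the closure adds only left limits φ(y⁻) at jumps. There F is left-continuous unless
the point is an integer or lies in a + ℤ, and the hypotheses of part 2 exclude both
(`map_mem_closure`, `tendsto_liftF_of_gap`). -/

/-- The left-continuous regularization of `psiFun`. -/
def psiLeft (lam d α z : ℝ) : ℝ := (1 - lam - d) * ((⌈z⌉ : ℝ) - 1) + d * (⌈z - α⌉ : ℝ)

/-- The left-continuous regularization of `phiFun`. -/
def phiLeft (lam d δ ρ α y : ℝ) : ℝ :=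
  δ / (1 - lam) +
    1 / lam * ∑' k : ℕ, lam ^ (k + 1) * psiLeft lam d α (y - ((k + 1 : ℕ) : ℝ) * ρ)

/-! ### The step function ψ and its one-sided limits -/

theorem stepFun_fract {α : ℝ} (hα : α ∈ Icc (0 : ℝ) 1) (z : ℝ) :
    stepFun α (Int.fract z) = (⌊z - α⌋ : ℝ) - ⌊z⌋ + 1 := by
  obtain ⟨h0, h1⟩ := hα
  have hz := Int.floor_add_fract z
  have hz0 := Int.fract_nonneg z
  have hz1 := Int.fract_lt_one z
  unfold stepFun
  split_ifs with h
  · have : ⌊z - α⌋ = ⌊z⌋ - 1 := by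
      rw [Int.floor_eq_iff]; push_cast; constructor <;> linarith
    rw [this]; push_cast; ring
  · have : ⌊z - α⌋ = ⌊z⌋ := by
      rw [Int.floor_eq_iff]; constructor <;> linarith
    rw [this]; ring

/-- Both coefficients are positive when 0 < d < 1-λ, so monotonicity and one-sided limits of ψ
reduce to those of two floors. -/
theorem psiFun_eq {α : ℝ} (hα : α ∈ Icc (0 : ℝ) 1) (lam d z : ℝ) :
    psiFun lam d α z = (1 - lam - d) * (⌊z⌋ : ℝ) + d * ((⌊z - α⌋ : ℝ) + 1) := by
  rw [psiFun, stepFun_fract hα]; ring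

theorem psiFun_add_int (lam d α z : ℝ) (n : ℤ) :
    psiFun lam d α (z + n) = psiFun lam d α z + (1 - lam) * n := by
  simp only [psiFun, Int.floor_add_intCast, Int.fract_add_intCast]; push_cast; ring

section

variable {lam d α : ℝ} (hlam : lam ∈ Ioo (0 : ℝ) 1) (hd : d ∈ Ioo (0 : ℝ) (1 - lam))
  (hα : α ∈ Icc (0 : ℝ) 1)

include hd hα in
theorem psiFun_mono : Monotone (psiFun lam d α) := by
  intro x y hxy
  rw [psiFun_eq hα, psiFun_eq hα]
  have h1 : (⌊x⌋ : ℝ) ≤ ⌊y⌋ := by exact_mod_cast Int.floor_le_floor hxy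
  have h2 : (⌊x - α⌋ : ℝ) ≤ ⌊y - α⌋ := by
    exact_mod_cast Int.floor_le_floor (sub_le_sub_right hxy α)
  have := hd.1
  have := hd.2
  gcongr

include hd hα in
theorem psiFun_lt {x y : ℝ} {n : ℤ} (hx : x < n) (hy : n ≤ y) :
    psiFun lam d α x < psiFun lam d α y := by
  rw [psiFun_eq hα, psiFun_eq hα]
  have h1 : (⌊x⌋ : ℝ) < ⌊y⌋ := by
    exact_mod_cast (Int.floor_lt.2 hx).trans_le (Int.le_floor.2 hy)
  have h2 : (⌊x - α⌋ : ℝ) ≤ ⌊y - α⌋ := by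
    exact_mod_cast Int.floor_le_floor (sub_le_sub_right (hx.le.trans hy) α)
  have := hd.1
  have := hd.2
  have h3 : (1 - lam - d) * (⌊x⌋ : ℝ) < (1 - lam - d) * ⌊y⌋ :=
    mul_lt_mul_of_pos_left h1 (by linarith)
  have h4 : d * ((⌊x - α⌋ : ℝ) + 1) ≤ d * ((⌊y - α⌋ : ℝ) + 1) := by gcongr
  linarith

include hlam hd in
theorem abs_psiFun_le (z : ℝ) : |psiFun lam d α z| ≤ |z| + 2 := by
  have hs : 0 ≤ stepFun α (Int.fract z) ∧ stepFun α (Int.fract z) ≤ 1 := by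
    unfold stepFun; split_ifs <;> norm_num
  have h1 := Int.floor_le z
  have h2 := Int.lt_floor_add_one z
  have hf : |(⌊z⌋ : ℝ)| ≤ |z| + 1 := by
    rw [abs_le]; constructor <;> cases abs_cases z <;> linarith
  have h3 : |(1 - lam) * (⌊z⌋ : ℝ)| ≤ |z| + 1 := by
    rw [abs_mul, abs_of_pos (by linarith [hlam.2] : 0 < 1 - lam)]
    nlinarith [hlam.1, abs_nonneg (⌊z⌋ : ℝ)]
  have h4 : |d * stepFun α (Int.fract z)| ≤ 1 := by
    rw [abs_of_nonneg (mul_nonneg hd.1.le hs.1)]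
    nlinarith [hd.1, hd.2, hlam.1]
  exact (abs_add_le _ _).trans (by linarith)

theorem eventually_floor_nhdsLT (z : ℝ) :
    ∀ᶠ x in 𝓝[<] z, ⌊x⌋ = ⌈z⌉ - 1 := by
  have : Ico ((⌈z⌉ : ℝ) - 1) z ∈ 𝓝[<] z :=
    Ico_mem_nhdsLT (by linarith [Int.ceil_lt_add_one z])
  filter_upwards [this] with x hx
  rw [Int.floor_eq_iff]
  push_cast
  exact ⟨hx.1, by linarith [hx.2, Int.le_ceil z]⟩

theorem tendsto_sub_const_nhdsLT (α z : ℝ) :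
    Tendsto (fun x : ℝ => x - α) (𝓝[<] z) (𝓝[<] (z - α)) := by
  refine tendsto_nhdsWithin_iff.2 ⟨?_, ?_⟩
  · exact (Continuous.tendsto (by fun_prop) z).mono_left nhdsWithin_le_nhds
  · filter_upwards [self_mem_nhdsWithin] with x hx
    exact sub_lt_sub_right hx α

include hα in
theorem tendsto_psiFun_nhdsLT (z : ℝ) :
    Tendsto (psiFun lam d α) (𝓝[<] z) (𝓝 (psiLeft lam d α z)) := by
  refine tendsto_const_nhds.congr' ?_
  filter_upwards [eventually_floor_nhdsLT z,
    (tendsto_sub_const_nhdsLT α z).eventually (eventually_floor_nhdsLT (z - α))] with x h1 h2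
  rw [psiFun_eq hα, h1, h2, psiLeft]; push_cast; ring

theorem eventually_floor_nhdsGE (z : ℝ) : ∀ᶠ x in 𝓝[≥] z, ⌊x⌋ = ⌊z⌋ := by
  have : Ico z ((⌊z⌋ : ℝ) + 1) ∈ 𝓝[≥] z := Ico_mem_nhdsGE (Int.lt_floor_add_one z)
  filter_upwards [this] with x hx
  rw [Int.floor_eq_iff]
  exact ⟨(Int.floor_le z).trans hx.1, hx.2⟩

include hα in
theorem tendsto_psiFun_nhdsGE (z : ℝ) :
    Tendsto (psiFun lam d α) (𝓝[≥] z) (𝓝 (psiFun lam d α z)) := by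
  have ht : Tendsto (fun x : ℝ => x - α) (𝓝[≥] z) (𝓝[≥] (z - α)) := by
    refine tendsto_nhdsWithin_iff.2 ⟨?_, ?_⟩
    · exact (Continuous.tendsto (by fun_prop) z).mono_left nhdsWithin_le_nhds
    · filter_upwards [self_mem_nhdsWithin] with x hx
      exact sub_le_sub_right (mem_Ici.1 hx) α
  refine tendsto_const_nhds.congr' ?_
  filter_upwards [eventually_floor_nhdsGE z,
    ht.eventually (eventually_floor_nhdsGE (z - α))] with x h1 h2
  rw [psiFun_eq hα, psiFun_eq hα, h1, h2]

include hα in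
theorem psiLeft_eq_psiFun {z : ℝ} (h1 : ∀ n : ℤ, z ≠ n) (h2 : ∀ n : ℤ, z - α ≠ n) :
    psiLeft lam d α z = psiFun lam d α z := by
  have key : ∀ w : ℝ, (∀ n : ℤ, w ≠ n) → ⌈w⌉ = ⌊w⌋ + 1 := by
    intro w hw
    rw [Int.ceil_eq_iff]
    push_cast
    exact ⟨by linarith [(Int.floor_le w).lt_of_ne' (hw _)], (Int.lt_floor_add_one w).le⟩
  rw [psiFun_eq hα, psiLeft, key z h1, key _ h2]; push_cast; ring

include hα in
-- Reflection turns floors into ceilings and α into 1-α; this is why δ(ρ,α) is built with θ_{1-α}.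
theorem psiFun_neg (z : ℝ) :
    psiFun lam d α (-z) = -(1 - lam - d) - psiLeft lam d (1 - α) z := by
  rw [psiFun_eq hα, psiLeft, ← neg_add', Int.floor_neg, Int.floor_neg,
    show z - (1 - α) = z + α - 1 by ring, Int.ceil_sub_one]
  push_cast; ring

include hα in
theorem psiLeft_neg (z : ℝ) :
    psiLeft lam d α (-z) = -(1 - lam - d) - psiFun lam d (1 - α) z := by
  rw [psiFun_eq (by constructor <;> linarith [hα.1, hα.2]), psiLeft, ← neg_add', Int.ceil_neg,
    Int.ceil_neg, show z - (1 - α) = z + α - 1 by ring, Int.floor_sub_one]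
  push_cast; ring

/-! ### Convergence and one-sided limits of the series φ -/

include hlam in
theorem summable_dominating (C : ℝ) : Summable fun k : ℕ => lam ^ (k + 1) * (C * ((k : ℝ) + 1)) := by
  have h := (summable_nat_add_iff 1).2
    (summable_pow_mul_geometric_of_norm_lt_one (R := ℝ) 1 (r := lam)
      (by rw [Real.norm_eq_abs, abs_of_pos hlam.1]; exact hlam.2))
  refine (h.mul_left C).congr fun k => ?_
  push_cast; ring

include hlam hd in
theorem norm_psi_term_le {u : ℕ → ℝ} {C : ℝ} (hu : ∀ k : ℕ, |u k| ≤ C * ((k : ℝ) + 1)) (k : ℕ) :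
    ‖lam ^ (k + 1) * psiFun lam d α (u k)‖ ≤ lam ^ (k + 1) * ((C + 2) * ((k : ℝ) + 1)) := by
  have hp : 0 < lam ^ (k + 1) := pow_pos hlam.1 _
  rw [Real.norm_eq_abs, abs_mul, abs_of_pos hp]
  refine mul_le_mul_of_nonneg_left ?_ hp.le
  have := hu k
  have := abs_psiFun_le (α := α) hlam hd (u k)
  nlinarith [Nat.cast_nonneg (α := ℝ) k]

include hlam hd in
theorem summable_psi {u : ℕ → ℝ} {C : ℝ} (hu : ∀ k : ℕ, |u k| ≤ C * ((k : ℝ) + 1)) :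
    Summable fun k : ℕ => lam ^ (k + 1) * psiFun lam d α (u k) :=
  Summable.of_norm_bounded (summable_dominating hlam (C + 2)) (norm_psi_term_le hlam hd hu)

include hlam hd in
-- Dominated convergence: ψ grows at most linearly, so λ^k times a linear bound in k dominates. It
-- serves limits both in y and in the rotation number.
theorem tendsto_psi_series {l : Filter ℝ} {u : ℝ → ℕ → ℝ} {g : ℕ → ℝ} {C : ℝ}
    (hu : ∀ᶠ r in l, ∀ k : ℕ, |u r k| ≤ C * ((k : ℝ) + 1))
    (hg : ∀ k, Tendsto (fun r => psiFun lam d α (u r k)) l (𝓝 (g k))) :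
    Tendsto (fun r => ∑' k : ℕ, lam ^ (k + 1) * psiFun lam d α (u r k)) l
      (𝓝 (∑' k : ℕ, lam ^ (k + 1) * g k)) := by
  refine tendsto_tsum_of_dominated_convergence (summable_dominating hlam (C + 2))
    (fun k => (hg k).const_mul _) ?_
  filter_upwards [hu] with r hr k using norm_psi_term_le hlam hd hr k

theorem abs_sub_mul_le (y ρ : ℝ) (k : ℕ) :
    |y - ((k + 1 : ℕ) : ℝ) * ρ| ≤ (|y| + |ρ|) * ((k : ℝ) + 1) := by
  have h := abs_sub y (((k + 1 : ℕ) : ℝ) * ρ)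
  rw [abs_mul, Nat.abs_cast] at h
  push_cast at h ⊢
  nlinarith [abs_nonneg y, Nat.cast_nonneg (α := ℝ) k]

theorem eventually_abs_le_add_one (y : ℝ) : ∀ᶠ x in 𝓝 y, |x| ≤ |y| + 1 :=
  (continuous_abs.tendsto y).eventually (eventually_le_nhds (by linarith))

include hlam hd in
theorem summable_phi (ρ y : ℝ) :
    Summable fun k : ℕ => lam ^ (k + 1) * psiFun lam d α (y - ((k + 1 : ℕ) : ℝ) * ρ) :=
  summable_psi hlam hd (abs_sub_mul_le y ρ)

include hlam hd in
theorem tendsto_phiFun {δ ρ y : ℝ} {l : Filter ℝ} (hl : l ≤ 𝓝 y) {g : ℕ → ℝ}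
    (hg : ∀ k : ℕ, Tendsto (fun x => psiFun lam d α (x - ((k + 1 : ℕ) : ℝ) * ρ)) l (𝓝 (g k))) :
    Tendsto (phiFun lam d δ ρ α) l
      (𝓝 (δ / (1 - lam) + 1 / lam * ∑' k : ℕ, lam ^ (k + 1) * g k)) := by
  refine ((tendsto_psi_series (C := |y| + 1 + |ρ|) hlam hd ?_ hg).const_mul _).const_add _
  filter_upwards [hl (eventually_abs_le_add_one y)] with x hx k
  exact (abs_sub_mul_le x ρ k).trans (by gcongr)

include hlam hd hα in
theorem tendsto_phiFun_nhdsLT (δ ρ y : ℝ) :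
    Tendsto (phiFun lam d δ ρ α) (𝓝[<] y) (𝓝 (phiLeft lam d δ ρ α y)) :=
  tendsto_phiFun hlam hd nhdsWithin_le_nhds fun _ =>
    (tendsto_psiFun_nhdsLT hα _).comp (tendsto_sub_const_nhdsLT _ y)

include hlam hd hα in
theorem tendsto_phiFun_nhdsGE (δ ρ y : ℝ) :
    Tendsto (phiFun lam d δ ρ α) (𝓝[≥] y) (𝓝 (phiFun lam d δ ρ α y)) := by
  refine tendsto_phiFun hlam hd nhdsWithin_le_nhds fun k =>
    (tendsto_psiFun_nhdsGE hα _).comp (tendsto_nhdsWithin_iff.2 ⟨?_, ?_⟩)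
  · exact (Continuous.tendsto (by fun_prop) y).mono_left nhdsWithin_le_nhds
  · filter_upwards [self_mem_nhdsWithin] with x hx
    exact sub_le_sub_right (mem_Ici.1 hx) _

include hα in
theorem phiLeft_eq_phiFun {δ ρ y : ℝ}
    (h : ∀ (k : ℕ) (n : ℤ), y - ((k + 1 : ℕ) : ℝ) * ρ ≠ n ∧ y - ((k + 1 : ℕ) : ℝ) * ρ - α ≠ n) :
    phiLeft lam d δ ρ α y = phiFun lam d δ ρ α y := by
  unfold phiLeft phiFun
  simp_rw [fun k : ℕ => psiLeft_eq_psiFun (lam := lam) (d := d) hα (fun n => (h k n).1) fun n => (h k n).2]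

/-! ### Functional equations and strict monotonicity of φ -/

include hlam hd in
theorem phiFun_add_int (δ ρ y : ℝ) (n : ℤ) :
    phiFun lam d δ ρ α (y + n) = phiFun lam d δ ρ α y + n := by
  unfold phiFun
  have hlam0 := hlam.1.ne'
  have h1 : ∀ k : ℕ, lam ^ (k + 1) * psiFun lam d α (y + n - ((k + 1 : ℕ) : ℝ) * ρ) =
      lam ^ (k + 1) * psiFun lam d α (y - ((k + 1 : ℕ) : ℝ) * ρ) +
        lam ^ k * (lam * (1 - lam) * n) := by
    intro k
    rw [add_sub_right_comm, psiFun_add_int]; ring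
  simp_rw [h1]
  rw [(summable_phi hlam hd ρ y).tsum_add
    ((summable_geometric_of_lt_one hlam.1.le hlam.2).mul_right _), tsum_mul_right,
    tsum_geometric_of_lt_one hlam.1.le hlam.2]
  have : 1 - lam ≠ 0 := by linarith [hlam.2]
  generalize ∑' k : ℕ, lam ^ (k + 1) * psiFun lam d α (y - ((k + 1 : ℕ) : ℝ) * ρ) = T
  field_simp
  ring

include hlam hd in
-- Translation by ρ shifts the index of the series by one; the term split off is ψ_α(y).
theorem phiFun_add_rot (δ ρ y : ℝ) :
    phiFun lam d δ ρ α (y + ρ) = lam * phiFun lam d δ ρ α y + δ + psiFun lam d α y := by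
  unfold phiFun
  rw [(summable_phi hlam hd ρ (y + ρ)).tsum_eq_zero_add]
  have h1 : ∀ k : ℕ, lam ^ (k + 1 + 1) * psiFun lam d α (y + ρ - ((k + 1 + 1 : ℕ) : ℝ) * ρ) =
      lam * (lam ^ (k + 1) * psiFun lam d α (y - ((k + 1 : ℕ) : ℝ) * ρ)) := by
    intro k
    rw [show y + ρ - ((k + 1 + 1 : ℕ) : ℝ) * ρ = y - ((k + 1 : ℕ) : ℝ) * ρ by push_cast; ring]
    ring
  simp_rw [h1]
  rw [tsum_mul_left, show y + ρ - ((0 + 1 : ℕ) : ℝ) * ρ = y by push_cast; ring]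
  have : 1 - lam ≠ 0 := by linarith [hlam.2]
  generalize ∑' k : ℕ, lam ^ (k + 1) * psiFun lam d α (y - ((k + 1 : ℕ) : ℝ) * ρ) = T
  have := hlam.1.ne'
  field_simp
  ring

theorem coe_eq_coe_iff_exists_int {x y : ℝ} :
    (x : UnitAddCircle) = y ↔ ∃ n : ℤ, x = y + n := by
  rw [← sub_eq_zero, ← AddCircle.coe_sub, AddCircle.coe_eq_zero_iff]
  refine exists_congr fun n => ?_
  rw [zsmul_one, eq_sub_iff_add_eq, add_comm, eq_comm]

theorem exists_nat_mul_add_int_mem {ρ : ℝ} (hρ : Irrational ρ) {y z : ℝ} (hyz : y < z) :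
    ∃ (k : ℕ) (n : ℤ), ((k + 1 : ℕ) : ℝ) * ρ + n ∈ Ioo y z := by
  have hd : DenseRange (fun n : ℕ => n • (ρ : UnitAddCircle)) :=
    denseRange_zsmul_iff_nsmul.1 (AddCircle.denseRange_zsmul_coe_iff.2 (by simpa using hρ))
  have hopen : IsOpen ((fun x : ℝ => (x : UnitAddCircle)) '' Ioo (y - ρ) (z - ρ)) :=
    QuotientAddGroup.isOpenMap_coe _ isOpen_Ioo
  obtain ⟨k, x, hx, hxk⟩ := hd.exists_mem_open hopen
    (Set.Nonempty.image _ (nonempty_Ioo.2 (by linarith)))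
  have hk : (x : UnitAddCircle) = ((k * ρ : ℝ) : UnitAddCircle) := by
    rw [← nsmul_eq_mul, AddCircle.coe_nsmul]; exact hxk
  obtain ⟨n, hn⟩ := coe_eq_coe_iff_exists_int.1 hk
  refine ⟨k, n, ?_⟩
  push_cast
  constructor <;> linarith [hx.1, hx.2]

include hlam hd hα in
-- By density of the orbit of ρ modulo one, some kρ + n with k ≥ 1 lies between y and z, so the k-th
-- term jumps at an integer; the other terms do not decrease.
theorem phiFun_strictMono (δ : ℝ) {ρ : ℝ} (hρ : Irrational ρ) :
    StrictMono (phiFun lam d δ ρ α) := by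
  intro y z hyz
  obtain ⟨k, n, hk⟩ := exists_nat_mul_add_int_mem hρ hyz
  have hlt : ∑' k : ℕ, lam ^ (k + 1) * psiFun lam d α (y - ((k + 1 : ℕ) : ℝ) * ρ) <
      ∑' k : ℕ, lam ^ (k + 1) * psiFun lam d α (z - ((k + 1 : ℕ) : ℝ) * ρ) := by
    refine Summable.tsum_lt_tsum (i := k) (fun j => ?_) ?_ (summable_phi hlam hd ρ y)
      (summable_phi hlam hd ρ z)
    · exact mul_le_mul_of_nonneg_left (psiFun_mono hd hα (by linarith)) (pow_pos hlam.1 _).le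
    · exact mul_lt_mul_of_pos_left
        (psiFun_lt hd hα (n := n) (by linarith [hk.1]) (by linarith [hk.2])) (pow_pos hlam.1 _)
  unfold phiFun
  have := mul_lt_mul_of_pos_left hlt (one_div_pos.2 hlam.1)
  linarith

/-! ### One-sided values of φ at 0 and α in terms of the parameters -/

include hlam in
theorem phi_zero_of_series (δ : ℝ) {g : ℕ → ℝ} (hg : Summable fun k => lam ^ (k + 1) * g k) :
    δ / (1 - lam) + 1 / lam * ∑' k : ℕ, lam ^ (k + 1) * (-(1 - lam - d) - g k) =
      (δ - (1 - lam - d + (1 - lam) / lam * ∑' k : ℕ, lam ^ (k + 1) * g k)) / (1 - lam) := by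
  have h1 : ∀ k : ℕ, lam ^ (k + 1) * (-(1 - lam - d) - g k) =
      lam ^ k * (-(lam * (1 - lam - d))) - lam ^ (k + 1) * g k := fun k => by ring
  simp_rw [h1]
  rw [((summable_geometric_of_lt_one hlam.1.le hlam.2).mul_right _).tsum_sub hg, tsum_mul_right,
    tsum_geometric_of_lt_one hlam.1.le hlam.2]
  have : 1 - lam ≠ 0 := by linarith [hlam.2]
  have := hlam.1.ne'
  field_simp
  ring

theorem abs_mul_le_of_abs_le {r C : ℝ} (hr : |r| ≤ C) (k : ℕ) :
    |((k + 1 : ℕ) : ℝ) * r| ≤ C * ((k : ℝ) + 1) := by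
  rw [abs_mul, Nat.abs_cast, mul_comm]
  push_cast
  gcongr

include hlam hd hα in
theorem phiLeft_zero (δ ρ : ℝ) :
    phiLeft lam d δ ρ α 0 = (δ - deltaFun lam d ρ α) / (1 - lam) := by
  unfold phiLeft
  simp_rw [zero_sub, psiLeft_neg hα]
  exact phi_zero_of_series hlam δ (summable_psi hlam hd (abs_mul_le_of_abs_le le_rfl))

include hlam hd hα in
theorem deltaLeft_eq (ρ : ℝ) :
    deltaLeft lam d ρ α = 1 - lam - d + (1 - lam) / lam *
      ∑' k : ℕ, lam ^ (k + 1) * psiLeft lam d (1 - α) (((k + 1 : ℕ) : ℝ) * ρ) := by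
  refine leftLim_eq_of_tendsto ?_
  refine ((tendsto_psi_series (α := 1 - α) (C := |ρ| + 1) (u := fun r k => ((k + 1 : ℕ) : ℝ) * r)
    hlam hd ?_ fun k => ?_).const_mul _).const_add _
  · filter_upwards [nhdsWithin_le_nhds (eventually_abs_le_add_one ρ)] with r hr k
    exact abs_mul_le_of_abs_le hr k
  · refine (tendsto_psiFun_nhdsLT (by constructor <;> linarith [hα.1, hα.2]) _).comp
      (tendsto_nhdsWithin_iff.2 ⟨?_, ?_⟩)
    · exact (Continuous.tendsto (by fun_prop) ρ).mono_left nhdsWithin_le_nhds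
    · filter_upwards [self_mem_nhdsWithin] with r hr
      exact mul_lt_mul_of_pos_left (mem_Iio.1 hr) (by positivity)

include hlam hd hα in
theorem phiFun_zero (δ ρ : ℝ) :
    phiFun lam d δ ρ α 0 = (δ - deltaLeft lam d ρ α) / (1 - lam) := by
  have hs := summable_phi (α := α) hlam hd ρ 0
  rw [deltaLeft_eq hlam hd hα]
  unfold phiFun
  simp_rw [zero_sub, psiFun_neg hα] at hs ⊢
  refine phi_zero_of_series hlam δ ?_
  have h2 := ((summable_geometric_of_lt_one hlam.1.le hlam.2).mul_right
    (-(lam * (1 - lam - d)))).sub hs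
  exact h2.congr fun k => by ring

include hlam hd hα in
-- As r decreases to ρ, the arguments α - kr approach α - kρ from below, so a right limit in the
-- rotation number is a left limit in y.
theorem aRight_eq (δ ρ : ℝ) : aRight lam d δ ρ α = phiLeft lam d δ ρ α α := by
  refine rightLim_eq_of_tendsto ?_
  refine ((tendsto_psi_series (C := |α| + (|ρ| + 1))
    (u := fun r k => α - ((k + 1 : ℕ) : ℝ) * r)
    hlam hd ?_ fun k => ?_).const_mul _).const_add _
  · filter_upwards [nhdsWithin_le_nhds (eventually_abs_le_add_one ρ)] with r hr k
    exact (abs_sub_mul_le α r k).trans (by gcongr)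
  · refine (tendsto_psiFun_nhdsLT hα _).comp (tendsto_nhdsWithin_iff.2 ⟨?_, ?_⟩)
    · exact (Continuous.tendsto (by fun_prop) ρ).mono_left nhdsWithin_le_nhds
    · filter_upwards [self_mem_nhdsWithin] with r hr
      have : ((k + 1 : ℕ) : ℝ) * ρ < ((k + 1 : ℕ) : ℝ) * r :=
        mul_lt_mul_of_pos_left hr (by positivity)
      exact sub_lt_sub_left this α

end

/-! ### Abstract lifts: the generalized inverse as a lower adjoint -/

/-- The generalized inverse of a function on the whole line. -/
def lowerInv (φ : ℝ → ℝ) (x : ℝ) : ℝ := sInf {y | x ≤ φ y}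

/-- A degree one, strictly increasing lift `F` conjugated by `φ` to the translation by `ρ`. -/
structure IsLiftConj (ρ : ℝ) (φ F : ℝ → ℝ) : Prop where
  strictMono : StrictMono φ
  rightCont : ∀ y, Tendsto φ (𝓝[≥] y) (𝓝 (φ y))
  add_int : ∀ y (n : ℤ), φ (y + n) = φ y + n
  inv_zero : lowerInv φ 0 = 0
  map_strictMono : StrictMono F
  map_add_int : ∀ y (n : ℤ), F (y + n) = F y + n
  map_phi : ∀ y, F (φ y) = φ (y + ρ)
  -- Far enough back along the rotation orbit, φ has no jump. All translates m are allowed since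
  -- iterates of f are known only modulo one.
  leftCont : ∀ y, ∃ N : ℕ, ∀ m : ℤ, Tendsto φ (𝓝[<] (y - N * ρ + m)) (𝓝 (φ (y - N * ρ + m)))

theorem gc_lowerInv {φ : ℝ → ℝ} (hm : Monotone φ)
    (hr : ∀ y, Tendsto φ (𝓝[≥] y) (𝓝 (φ y))) (ha : ∀ y (n : ℤ), φ (y + n) = φ y + n) :
    GaloisConnection (lowerInv φ) φ := by
  have hne : ∀ x, {y | x ≤ φ y}.Nonempty := fun x => by
    refine ⟨0 + (⌈x - φ 0⌉ : ℤ), ?_⟩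
    change x ≤ φ _
    rw [ha]
    linarith [Int.le_ceil (x - φ 0)]
  have hbdd : ∀ x, BddBelow {y | x ≤ φ y} := fun x => by
    refine ⟨0 + (⌊x - φ 0⌋ - 1 : ℤ), fun y hy => ?_⟩
    by_contra! hlt
    have h1 := hm hlt.le
    rw [ha] at h1
    push_cast at h1
    have h2 : x ≤ φ y := hy
    linarith [Int.floor_le (x - φ 0)]
  intro x y
  refine ⟨fun h => ?_, fun h => csInf_le (hbdd x) h⟩
  -- What remains is that the infimum is attained, which follows from right continuity of φ.
  refine le_trans ?_ (hm h)
  refine ge_of_tendsto ((hr (lowerInv φ x)).mono_left (nhdsWithin_mono _ Ioi_subset_Ici_self)) ?_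
  filter_upwards [self_mem_nhdsWithin] with z hz
  obtain ⟨s, hs, hsz⟩ := exists_lt_of_csInf_lt (hne x) (mem_Ioi.1 hz)
  exact le_trans hs (hm hsz.le)

namespace GaloisConnection

variable {φ : ℝ → ℝ} (gc : GaloisConnection (lowerInv φ) φ)
include gc

theorem lowerInv_phi (hφ : StrictMono φ) (y : ℝ) : lowerInv φ (φ y) = y :=
  hφ.injective (gc.u_l_u_eq_u y)

theorem lowerInv_add_int (ha : ∀ y (n : ℤ), φ (y + n) = φ y + n) (x : ℝ) (n : ℤ) :
    lowerInv φ (x + n) = lowerInv φ x + n := by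
  refine eq_of_forall_ge_iff fun y => ?_
  have h := ha (y - n) n
  rw [sub_add_cancel] at h
  rw [gc _ _, h, add_le_add_iff_right, ← gc _ _, le_sub_iff_add_le]

theorem lowerInv_eq (hφ : StrictMono φ) {x y l : ℝ} (hl : Tendsto φ (𝓝[<] y) (𝓝 l)) (hlx : l ≤ x)
    (hx : x ≤ φ y) : lowerInv φ x = y := by
  refine le_antisymm ((gc _ _).2 hx) ?_
  by_contra! hlt
  obtain ⟨z, hz1, hz2⟩ := exists_between hlt
  have h1 : φ z ≤ l := by
    refine ge_of_tendsto hl ?_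
    filter_upwards [Ioo_mem_nhdsLT hz2] with w hw using hφ.monotone hw.1.le
  have h2 := hφ hz1
  have h3 := gc.le_u_l x
  linarith

/-- For integers n, the adjunction gives b + n ≤ φ(y) ↔ c + n ≤ y. Used with (b,c) = (0,0) and
(a,α). -/
theorem floor_phi_sub (ha : ∀ y (n : ℤ), φ (y + n) = φ y + n) {b c : ℝ}
    (hb : lowerInv φ b = c) (y : ℝ) : ⌊φ y - b⌋ = ⌊y - c⌋ := by
  refine eq_of_forall_le_iff fun n => ?_
  have h := gc.lowerInv_add_int ha b n
  rw [hb] at h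
  rw [Int.le_floor, Int.le_floor, le_sub_iff_add_le', le_sub_iff_add_le', ← gc _ _, h]

theorem phi_lt_of_lt {x y : ℝ} (h : y < lowerInv φ x) : φ y < x :=
  lt_of_not_ge fun hx => h.not_ge ((gc _ _).2 hx)

theorem phi_lowerInv_eq {x : ℝ} (h : Tendsto φ (𝓝[<] (lowerInv φ x)) (𝓝 (φ (lowerInv φ x)))) :
    φ (lowerInv φ x) = x := by
  refine le_antisymm (le_of_tendsto h ?_) (gc.le_u_l x)
  filter_upwards [self_mem_nhdsWithin] with y hy using (gc.phi_lt_of_lt hy).le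

end GaloisConnection

theorem fract_fract_add (x y : ℝ) : Int.fract (Int.fract x + y) = Int.fract (x + y) := by
  rw [← Int.self_sub_floor x, sub_add_eq_add_sub, Int.fract_sub_intCast]

theorem circle_coe_fract (x : ℝ) : ((Int.fract x : ℝ) : UnitAddCircle) = x := by
  rw [coe_eq_coe_iff_exists_int]
  exact ⟨-⌊x⌋, by push_cast; rw [← sub_eq_add_neg, Int.self_sub_floor]⟩

namespace IsLiftConj

variable {ρ : ℝ} {φ F : ℝ → ℝ} (L : IsLiftConj ρ φ F)
include L

theorem gc : GaloisConnection (lowerInv φ) φ :=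
  gc_lowerInv L.strictMono.monotone L.rightCont L.add_int

theorem inv_phi (y : ℝ) : lowerInv φ (φ y) = y := L.gc.lowerInv_phi L.strictMono y

theorem inv_add_int (x : ℝ) (n : ℤ) : lowerInv φ (x + n) = lowerInv φ x + n :=
  L.gc.lowerInv_add_int L.add_int x n

/-- A monotone function onto ℝ has no jumps. -/
theorem inv_continuous : Continuous (lowerInv φ) :=
  L.gc.monotone_l.continuous_of_surjective fun y => ⟨φ y, L.inv_phi y⟩

theorem inv_map (x : ℝ) : lowerInv φ (F x) = lowerInv φ x + ρ := by
  refine le_antisymm ((L.gc _ _).2 ?_) ?_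
  · rw [← L.map_phi]
    exact L.map_strictMono.monotone (L.gc.le_u_l x)
  · have h := L.gc.le_u_l (F x)
    -- With η(F(x)) written as y + ρ, the bound F(x) ≤ φ(y+ρ) = F(φ(y)) can be cancelled to x ≤
    -- φ(y).
    rw [← sub_add_cancel (lowerInv φ (F x)) ρ, ← L.map_phi, L.map_strictMono.le_iff_le,
      ← L.gc _ _] at h
    linarith

theorem floor_phi (y : ℝ) : ⌊φ y⌋ = ⌊y⌋ := by
  simpa using L.gc.floor_phi_sub L.add_int L.inv_zero y

theorem phi_mem {y : ℝ} (hy : y ∈ Ico (0 : ℝ) 1) : φ y ∈ Ico (0 : ℝ) 1 := by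
  rw [← Int.floor_eq_zero_iff] at hy ⊢
  rw [L.floor_phi, hy]

theorem inv_mem {x : ℝ} (hx : φ (lowerInv φ x) = x) (h : x ∈ Ico (0 : ℝ) 1) :
    lowerInv φ x ∈ Ico (0 : ℝ) 1 := by
  rw [← Int.floor_eq_zero_iff] at h ⊢
  rwa [← L.floor_phi, hx]

theorem phi_fract (y : ℝ) : φ (Int.fract y) = Int.fract (φ y) := by
  have h := L.add_int (Int.fract y) ⌊y⌋
  rw [Int.fract_add_floor] at h
  rw [← Int.self_sub_floor (φ y), L.floor_phi, h, add_sub_cancel_right]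

/-- The generalized inverse, modulo one. -/
def _root_.fractInv (φ : ℝ → ℝ) (x : UnitIco) : UnitIco :=
  ⟨Int.fract (lowerInv φ x), Int.fract_nonneg _, Int.fract_lt_one _⟩

theorem mem_invDomain_iff (x : UnitIco) :
    x ∈ invDomain φ ↔ φ 0 ≤ x ∧ lowerInv φ x < 1 := by
  refine and_congr_right fun _ => ⟨fun h => ?_, fun h => ?_⟩
  · have := (L.strictMono.monotone.tendsto_leftLim 1).eventually (eventually_gt_nhds h)
    obtain ⟨y, hy, hy1⟩ := (this.and self_mem_nhdsWithin).exists
    exact lt_of_le_of_lt ((L.gc _ _).2 (le_of_lt hy)) hy1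
  · obtain ⟨z, hz, hz1⟩ := exists_between h
    exact lt_of_lt_of_le (lt_of_le_of_lt (L.gc.le_u_l _) (L.strictMono hz))
      (L.strictMono.monotone.le_leftLim hz1)

theorem inv_nonneg (x : UnitIco) : 0 ≤ lowerInv φ x := by
  have := L.gc.monotone_l x.2.1
  rwa [L.inv_zero] at this

theorem nonempty_of_mem_invDomain {x : UnitIco} (hx : x ∈ invDomain φ) :
    lowerInv φ x ∈ {y : ℝ | y ∈ Ico (0 : ℝ) 1 ∧ (x : ℝ) ≤ φ y} :=
  ⟨⟨L.inv_nonneg x, ((L.mem_invDomain_iff x).1 hx).2⟩, L.gc.le_u_l _⟩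

theorem genInv_eq {x : UnitIco} (hx : x ∈ invDomain φ) :
    (genInv φ x : ℝ) = lowerInv φ x := by
  have : IsLeast {y : ℝ | y ∈ Ico (0 : ℝ) 1 ∧ (x : ℝ) ≤ φ y} (lowerInv φ x) :=
    ⟨L.nonempty_of_mem_invDomain hx, fun y hy => (L.gc _ _).2 hy.2⟩
  exact this.csInf_eq

theorem genInv_eq_fractInv {x : UnitIco} (hx : x ∈ invDomain φ) :
    genInv φ x = fractInv φ x := by
  apply Subtype.ext
  rw [L.genInv_eq hx]
  exact (Int.fract_eq_self.2 (L.nonempty_of_mem_invDomain hx).1).symm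

theorem continuousOn_genInv : ContinuousOn (genInv φ) (invDomain φ) := by
  rw [Topology.IsInducing.subtypeVal.continuousOn_iff]
  exact (L.inv_continuous.comp continuous_subtype_val).continuousOn.congr
    fun x hx => L.genInv_eq hx

theorem continuous_fractInv :
    @Continuous UnitIco UnitIco circleTopology circleTopology (fractInv φ) := by
  have hper : Function.Periodic (fun x : ℝ => ((lowerInv φ x : ℝ) : UnitAddCircle)) 1 := by
    intro x
    rw [coe_eq_coe_iff_exists_int]
    exact ⟨1, by simpa using L.inv_add_int x 1⟩
  have hcont : Continuous hper.lift :=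
    continuous_coinduced_dom.2 ((AddCircle.continuous_mk' 1).comp L.inv_continuous)
  refine (continuous_induced_rng (t₁ := circleTopology)).2 ?_
  have heq : (fun x : UnitIco => ((x : ℝ) : UnitAddCircle)) ∘ fractInv φ =
      hper.lift ∘ fun x : UnitIco => ((x : ℝ) : UnitAddCircle) := by
    funext x
    exact (circle_coe_fract _).trans (hper.lift_coe _).symm
  rw [heq]
  exact @Continuous.comp _ _ _ circleTopology _ _ _ _ hcont continuous_induced_dom

/-! ### The attractor and its circle closure -/

section

variable {f : UnitIco → UnitIco} (hf : ∀ x, (f x : ℝ) = Int.fract (F x))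
include hf

theorem inv_apply (x : UnitIco) : ∃ m : ℤ, (f x : ℝ) = F x + m ∧
    lowerInv φ (f x) = lowerInv φ x + ρ + m := by
  refine ⟨-⌊F x⌋, ?_, ?_⟩
  · rw [hf, Int.fract]; push_cast; ring
  · rw [hf, ← L.inv_map, ← L.inv_add_int, Int.fract]; push_cast; rw [sub_eq_add_neg]

theorem phi_inv_apply {x : UnitIco} (hx : φ (lowerInv φ x) = x) :
    φ (lowerInv φ (f x)) = f x := by
  obtain ⟨m, h1, h2⟩ := L.inv_apply hf x
  rw [h2, h1, L.add_int, ← L.map_phi, hx]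

theorem phi_inv_iterate {x : UnitIco} (n : ℕ) (hx : φ (lowerInv φ x) = x) :
    φ (lowerInv φ (f^[n] x)) = f^[n] x := by
  induction n with
  | zero => exact hx
  | succ n ih => rw [Function.iterate_succ_apply']; exact L.phi_inv_apply hf ih

theorem inv_iterate (x : UnitIco) (n : ℕ) :
    ∃ m : ℤ, lowerInv φ (f^[n] x) = lowerInv φ x + n * ρ + m := by
  induction n with
  | zero => exact ⟨0, by simp⟩
  | succ n ih =>
    obtain ⟨m, hm⟩ := ih
    obtain ⟨m', -, hm'⟩ := L.inv_apply hf (f^[n] x)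
    refine ⟨m + m', ?_⟩
    rw [Function.iterate_succ_apply', hm', hm]; push_cast; ring

theorem exists_preimage {x : UnitIco} (hx : φ (lowerInv φ x) = x) :
    ∃ w : UnitIco, φ (lowerInv φ w) = w ∧ f w = x := by
  refine ⟨⟨φ (Int.fract (lowerInv φ x - ρ)),
    L.phi_mem ⟨Int.fract_nonneg _, Int.fract_lt_one _⟩⟩, ?_, ?_⟩
  · rw [L.inv_phi]
  · apply Subtype.ext
    rw [hf, L.map_phi, ← L.phi_fract, fract_fract_add, sub_add_cancel, L.phi_fract, hx,
      Int.fract_eq_self.2 x.2]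

/-- The attractor is the image of `φ`. -/
theorem mem_attractor_iff (x : UnitIco) :
    x ∈ ⋂ n : ℕ, f^[n] '' univ ↔ φ (lowerInv φ x) = x := by
  rw [mem_iInter]
  constructor
  · intro h
    -- An N-th preimage w has η(w) = η(x) - Nρ modulo integers, where φ is left-continuous; so
    -- φ(η(w)) = w, and this passes to x.
    obtain ⟨N, hN⟩ := L.leftCont (lowerInv φ x)
    obtain ⟨w, -, rfl⟩ := h N
    obtain ⟨m, hm⟩ := L.inv_iterate hf w N
    refine L.phi_inv_iterate hf N (L.gc.phi_lowerInv_eq ?_)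
    convert hN (-m) using 3 <;> rw [hm] <;> push_cast <;> ring
  · intro h n
    induction n generalizing x with
    | zero => exact ⟨x, trivial, rfl⟩
    | succ n ih =>
      obtain ⟨w, hw, rfl⟩ := L.exists_preimage hf h
      obtain ⟨v, -, rfl⟩ := ih w hw
      exact ⟨v, trivial, Function.iterate_succ_apply' _ _ _⟩

theorem attractor_subset : (⋂ n : ℕ, f^[n] '' univ) ⊆ invDomain φ := by
  intro x hx
  rw [L.mem_attractor_iff hf] at hx
  have h := L.inv_mem hx x.2
  exact (L.mem_invDomain_iff x).2 ⟨hx ▸ L.strictMono.monotone h.1, h.2⟩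

theorem mapsTo_attractor : MapsTo f (⋂ n : ℕ, f^[n] '' univ) (⋂ n : ℕ, f^[n] '' univ) := by
  intro x hx
  rw [L.mem_attractor_iff hf] at hx ⊢
  exact L.phi_inv_apply hf hx

theorem fractInv_apply (x : UnitIco) : fractInv φ (f x) = circleRot ρ (fractInv φ x) := by
  obtain ⟨m, -, h⟩ := L.inv_apply hf x
  apply Subtype.ext
  change Int.fract _ = Int.fract (Int.fract _ + ρ)
  rw [h, Int.fract_add_intCast, fract_fract_add]

theorem surjOn_fractInv : SurjOn (fractInv φ) (⋂ n : ℕ, f^[n] '' univ) univ := by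
  intro y _
  refine ⟨⟨φ y, L.phi_mem y.2⟩, ?_, ?_⟩
  · rw [L.mem_attractor_iff hf]
    exact congrArg φ (L.inv_phi y)
  · apply Subtype.ext
    change Int.fract (lowerInv φ (φ y)) = y
    rw [L.inv_phi, Int.fract_eq_self.2 y.2]

theorem isTopSemiconjOn_fractInv {t : TopologicalSpace UnitIco} {S : Set UnitIco}
    (hS : (⋂ n : ℕ, f^[n] '' univ) ⊆ S) (hmaps : MapsTo f S S) {g : UnitIco → UnitIco}
    (hg : EqOn g (fractInv φ) S) (hcont : @ContinuousOn _ _ t t g S) :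
    IsTopSemiconjOn t t S f (circleRot ρ) g where
  mapsTo := hmaps
  continuousOn := hcont
  surjOn := (SurjOn.mono hS subset_rfl (L.surjOn_fractInv hf)).congr hg.symm
  semiconj x hx := by rw [hg hx, hg (hmaps hx), L.fractInv_apply hf]

/-- The quotient map is open and continuous, so closures pull back, and the preimage of the
attractor in ℝ is the range of φ. -/
theorem mem_circle_closure_iff (r : ℝ) :
    (r : UnitAddCircle) ∈ closure ((fun x : UnitIco => ((x : ℝ) : UnitAddCircle)) ''
      ⋂ n : ℕ, f^[n] '' univ) ↔ r ∈ closure (range φ) := by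
  rw [← mem_preimage, IsOpenMap.preimage_closure_eq_closure_preimage
    QuotientAddGroup.isOpenMap_coe (AddCircle.continuous_mk' 1)]
  refine iff_of_eq (congrArg (r ∈ closure ·) (Set.ext fun s => ?_))
  constructor
  · rintro ⟨x, hx, hxs⟩
    rw [L.mem_attractor_iff hf] at hx
    obtain ⟨n, hn⟩ := coe_eq_coe_iff_exists_int.1 hxs
    refine ⟨lowerInv φ x + (-n : ℤ), ?_⟩
    rw [L.add_int, hx, hn]; push_cast; ring
  · rintro ⟨y, rfl⟩
    refine ⟨⟨φ (Int.fract y), L.phi_mem ⟨Int.fract_nonneg _, Int.fract_lt_one _⟩⟩, ?_, ?_⟩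
    · rw [L.mem_attractor_iff hf]
      exact congrArg φ (L.inv_phi _)
    · change ((φ (Int.fract y) : ℝ) : UnitAddCircle) = _
      rw [L.phi_fract, circle_coe_fract]

end

/-- Values of φ near x lie below φ(η(x)), hence are taken to the left of η(x), while φ < x there. -/
theorem tendsto_of_mem_closure {x : ℝ} (hx : x ∈ closure (range φ)) (hlt : x < φ (lowerInv φ x)) :
    Tendsto φ (𝓝[<] (lowerInv φ x)) (𝓝 x) := by
  refine tendsto_order.2 ⟨fun b hb => ?_, fun b hb => ?_⟩
  · obtain ⟨_, ⟨hz1, hz2⟩, z, rfl⟩ := mem_closure_iff_nhds.1 hx _ (Ioo_mem_nhds hb hlt)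
    filter_upwards [Ioo_mem_nhdsLT (L.strictMono.lt_iff_lt.1 hz2)] with y hy
    exact hz1.trans (L.strictMono hy.1)
  · filter_upwards [self_mem_nhdsWithin] with y hy
    exact (L.gc.phi_lt_of_lt hy).trans hb

/-- At a gap, x is a left limit of φ(y), and left continuity of F makes F(x) the limit of F(φ(y)) =
φ(y+ρ). -/
theorem map_mem_closure {x : ℝ} (hx : x ∈ closure (range φ))
    (hleft : x < φ (lowerInv φ x) → Tendsto φ (𝓝[<] (lowerInv φ x)) (𝓝 x) →
      Tendsto F (𝓝[<] x) (𝓝 (F x))) : F x ∈ closure (range φ) := by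
  rcases (L.gc.le_u_l x).eq_or_lt with h | h
  · rw [h, L.map_phi]; exact subset_closure ⟨_, rfl⟩
  · have ht := L.tendsto_of_mem_closure hx h
    have ht' : Tendsto φ (𝓝[<] (lowerInv φ x)) (𝓝[<] x) := by
      refine tendsto_nhdsWithin_iff.2 ⟨ht, ?_⟩
      filter_upwards [self_mem_nhdsWithin] with y hy using L.gc.phi_lt_of_lt hy
    refine mem_closure_of_tendsto ((hleft h ht).comp ht') (Eventually.of_forall fun y => ?_)
    exact ⟨y + ρ, (L.map_phi y).symm⟩

theorem mapsTo_closure {f : UnitIco → UnitIco} (hf : ∀ x, (f x : ℝ) = Int.fract (F x))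
    (hleft : ∀ x : UnitIco, (x : ℝ) < φ (lowerInv φ x) → Tendsto φ (𝓝[<] (lowerInv φ x)) (𝓝 x) →
      Tendsto F (𝓝[<] x) (𝓝 (F x))) :
    MapsTo f (@closure UnitIco circleTopology (⋂ n : ℕ, f^[n] '' univ))
      (@closure UnitIco circleTopology (⋂ n : ℕ, f^[n] '' univ)) := by
  intro x hx
  rw [closure_induced] at hx ⊢
  rw [hf, circle_coe_fract, L.mem_circle_closure_iff hf]
  exact L.map_mem_closure ((L.mem_circle_closure_iff hf _).1 hx) (hleft x)

end IsLiftConj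

/-! ### The concrete φ and F form such a lift -/

section

variable {lam d ρ α δ a : ℝ} (hlam : lam ∈ Ioo (0 : ℝ) 1) (hd : d ∈ Ioo (0 : ℝ) (1 - lam))
  (hirr : Irrational ρ) (hα : α ∈ Icc (0 : ℝ) 1)

include hlam hd hα in
theorem phiFun_zero_nonneg (hδ : deltaLeft lam d ρ α ≤ δ) : 0 ≤ phiFun lam d δ ρ α 0 := by
  rw [phiFun_zero hlam hd hα]
  exact div_nonneg (sub_nonneg.2 hδ) (by linarith [hlam.2])

include hlam hd hα in
theorem phiLeft_zero_nonpos (hδ : δ ≤ deltaFun lam d ρ α) : phiLeft lam d δ ρ α 0 ≤ 0 := by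
  rw [phiLeft_zero hlam hd hα]
  exact div_nonpos_of_nonpos_of_nonneg (sub_nonpos.2 hδ) (by linarith [hlam.2])

theorem psiFun_eq_of_inv {φ : ℝ → ℝ} (gc : GaloisConnection (lowerInv φ) φ)
    (hφ : ∀ y (n : ℤ), φ (y + n) = φ y + n) (hα : α ∈ Icc (0 : ℝ) 1) (ha : a ∈ Icc (0 : ℝ) 1)
    (h0 : lowerInv φ 0 = 0) (h1 : lowerInv φ a = α) (y : ℝ) :
    psiFun lam d a (φ y) = psiFun lam d α y := by
  have e0 := gc.floor_phi_sub hφ h0 y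
  rw [sub_zero, sub_zero] at e0
  rw [psiFun_eq ha, psiFun_eq hα, e0, gc.floor_phi_sub hφ h1]

theorem liftF_eq (lam d δ a x : ℝ) : liftF lam d δ a x = lam * x + δ + psiFun lam d a x := by
  rw [liftF, psiFun]; ring

theorem intCast_ne_mul (hirr : Irrational ρ) {k : ℤ} (hk : k ≠ 0) (n : ℤ) : (k : ℝ) * ρ ≠ n :=
  (hirr.intCast_mul hk).ne_int n

/-- Two such n would make a nonzero integer multiple of ρ an integer, so at most one n is
exceptional. -/
theorem exists_nat_forall_ne_int (hirr : Irrational ρ) (y : ℝ) :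
    ∃ N : ℕ, ∀ n : ℕ, N < n → ∀ m : ℤ, y - n * ρ ≠ m := by
  by_cases h : ∃ (N : ℕ) (m : ℤ), y - N * ρ = m
  · obtain ⟨N, m, hN⟩ := h
    refine ⟨N, fun n hn k hk => ?_⟩
    refine intCast_ne_mul hirr (k := (n : ℤ) - N) (by omega) (m - k) ?_
    push_cast
    linarith
  · push Not at h
    exact ⟨0, fun n _ m => h n m⟩

include hlam hd hirr hα in
theorem exists_backward_leftCont (δ y : ℝ) : ∃ N : ℕ, ∀ m : ℤ,
    Tendsto (phiFun lam d δ ρ α) (𝓝[<] (y - N * ρ + m))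
      (𝓝 (phiFun lam d δ ρ α (y - N * ρ + m))) := by
  obtain ⟨N₁, h₁⟩ := exists_nat_forall_ne_int hirr y
  obtain ⟨N₂, h₂⟩ := exists_nat_forall_ne_int hirr (y - α)
  refine ⟨N₁ + N₂, fun m => ?_⟩
  rw [← phiLeft_eq_phiFun hα]
  · exact tendsto_phiFun_nhdsLT hlam hd hα _ _ _
  · refine fun k n => ⟨fun h => h₁ (N₁ + N₂ + (k + 1)) (by omega) (n - m) ?_,
      fun h => h₂ (N₁ + N₂ + (k + 1)) (by omega) (n - m) ?_⟩ <;>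
    · push_cast at h ⊢
      linarith

theorem sub_mul_ne_int (hirr : Irrational ρ) (j : ℤ) (k : ℕ) (n : ℤ) :
    (j : ℝ) - ((k + 1 : ℕ) : ℝ) * ρ ≠ n := by
  intro h
  refine intCast_ne_mul hirr (k := (k + 1 : ℕ)) (by omega) (j - n) ?_
  push_cast at h ⊢
  linarith

/-- The only obstruction to continuity of `φ` at `0`. -/
theorem phiLeft_zero_eq (hα : α ∈ Icc (0 : ℝ) 1) (hirr : Irrational ρ)
    (h : ¬∃ k ∈ resonances ρ α, k < 0) :
    phiLeft lam d δ ρ α 0 = phiFun lam d δ ρ α 0 := by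
  refine phiLeft_eq_phiFun hα fun k n => ⟨?_, fun hk => ?_⟩
  · have := sub_mul_ne_int hirr 0 k n
    simpa using this
  · refine h ⟨-(k + 1 : ℕ), ⟨by omega, n, ?_⟩, by omega⟩
    push_cast at hk ⊢
    linarith

/-- The only obstruction to continuity of `φ` at `α`. -/
theorem phiLeft_self_eq (hα : α ∈ Icc (0 : ℝ) 1) (hirr : Irrational ρ)
    (h : ¬∃ k ∈ resonances ρ α, 0 < k) :
    phiLeft lam d δ ρ α α = phiFun lam d δ ρ α α := by
  refine phiLeft_eq_phiFun hα fun k n => ⟨fun hk => ?_, fun hk => ?_⟩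
  · refine h ⟨(k + 1 : ℕ), ⟨by omega, -n, ?_⟩, by omega⟩
    push_cast at hk ⊢
    linarith
  · refine sub_mul_ne_int hirr 0 k n ?_
    push_cast at hk ⊢
    linarith

theorem resonances_int (hirr : Irrational ρ) (j : ℤ) : resonances ρ j = ∅ := by
  refine eq_empty_of_forall_notMem fun k ⟨hk, m, hm⟩ => ?_
  refine intCast_ne_mul hirr hk (m + j) ?_
  rw [hm]; push_cast; ring

include hlam hd hirr hα in
-- The floor formula for θ_a needs a ∈ [0,1]. For 0 < α < 1 this follows from monotonicity of η; for
-- α = 0 or 1, φ has no jump at α, which forces a = α.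
theorem inv_threshold_mem (h0 : lowerInv (phiFun lam d δ ρ α) 0 = 0)
    (h1 : lowerInv (phiFun lam d δ ρ α) a = α) : a ∈ Icc (0 : ℝ) 1 := by
  have gc := gc_lowerInv (phiFun_strictMono hlam hd hα δ hirr).monotone
    (tendsto_phiFun_nhdsGE hlam hd hα δ ρ) (phiFun_add_int hlam hd δ ρ)
  have hint : ∀ j : ℤ, lowerInv (phiFun lam d δ ρ α) j = j := fun j => by
    simpa [h0] using gc.lowerInv_add_int (phiFun_add_int hlam hd δ ρ) 0 j
  have key : ∀ j : ℤ, α = j → a = j := by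
    intro j hj
    have hc : Tendsto (phiFun lam d δ ρ α) (𝓝[<] (j : ℝ)) (𝓝 (phiFun lam d δ ρ α j)) := by
      have h2 := phiLeft_self_eq (lam := lam) (d := d) (δ := δ) (ρ := ρ) hα hirr
        (by rw [hj, resonances_int hirr]; simp)
      rw [← hj, ← h2]
      exact tendsto_phiFun_nhdsLT hlam hd hα _ _ _
    have e1 := gc.phi_lowerInv_eq (x := a) (by rwa [h1.trans hj])
    have e2 := gc.phi_lowerInv_eq (x := (j : ℝ)) (by rwa [hint])
    rw [h1.trans hj] at e1
    rw [hint] at e2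
    exact e1.symm.trans e2
  constructor
  · rcases hα.1.eq_or_lt with h | h
    · have := key 0 (by simpa using h.symm)
      simp [this]
    · refine (gc.monotone_l.reflect_lt ?_).le
      rwa [h0, h1]
  · rcases hα.2.eq_or_lt with h | h
    · have := key 1 (by simpa using h)
      simp [this]
    · refine (gc.monotone_l.reflect_lt ?_).le
      have := hint 1
      push_cast at this
      rwa [this, h1]

include hlam hd in
theorem liftF_strictMono (ha : a ∈ Icc (0 : ℝ) 1) (δ : ℝ) : StrictMono (liftF lam d δ a) := by
  intro x y hxy
  rw [liftF_eq, liftF_eq]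
  have := mul_lt_mul_of_pos_left hxy hlam.1
  have := psiFun_mono hd ha hxy.le
  linarith

theorem tendsto_liftF_nhdsLT (ha : a ∈ Icc (0 : ℝ) 1) (lam d δ : ℝ) {x : ℝ}
    (h1 : ∀ n : ℤ, x ≠ n) (h2 : ∀ n : ℤ, x - a ≠ n) :
    Tendsto (liftF lam d δ a) (𝓝[<] x) (𝓝 (liftF lam d δ a x)) := by
  have e : liftF lam d δ a = fun x => lam * x + δ + psiFun lam d a x :=
    funext fun x => liftF_eq lam d δ a x
  rw [e]
  have h := tendsto_psiFun_nhdsLT (lam := lam) (d := d) ha x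
  rw [psiLeft_eq_psiFun ha h1 h2] at h
  exact ((Continuous.tendsto (by fun_prop) x).mono_left nhdsWithin_le_nhds).add h

include hlam hd hirr hα in
theorem inv_zero_of_mem (hδ : δ ∈ Icc (deltaLeft lam d ρ α) (deltaFun lam d ρ α)) :
    lowerInv (phiFun lam d δ ρ α) 0 = 0 :=
  (gc_lowerInv (phiFun_strictMono hlam hd hα δ hirr).monotone
    (tendsto_phiFun_nhdsGE hlam hd hα δ ρ) (phiFun_add_int hlam hd δ ρ)).lowerInv_eq
    (phiFun_strictMono hlam hd hα δ hirr) (tendsto_phiFun_nhdsLT hlam hd hα δ ρ 0)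
    (phiLeft_zero_nonpos hlam hd hα hδ.2) (phiFun_zero_nonneg hlam hd hα hδ.1)

include hlam hd hirr hα in
theorem inv_threshold_of_mem (ha : a ∈ Icc (aRight lam d δ ρ α) (aFun lam d δ ρ α)) :
    lowerInv (phiFun lam d δ ρ α) a = α :=
  (gc_lowerInv (phiFun_strictMono hlam hd hα δ hirr).monotone
    (tendsto_phiFun_nhdsGE hlam hd hα δ ρ) (phiFun_add_int hlam hd δ ρ)).lowerInv_eq
    (phiFun_strictMono hlam hd hα δ hirr) (tendsto_phiFun_nhdsLT hlam hd hα δ ρ α)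
    -- The upper bound needs no rewriting: `aFun` is `phiFun` at α by definition.
    (aRight_eq hlam hd hα δ ρ ▸ ha.1) ha.2

include hlam hd hirr hα in
theorem isLiftConj_phiFun (hδ : δ ∈ Icc (deltaLeft lam d ρ α) (deltaFun lam d ρ α))
    (ha : a ∈ Icc (aRight lam d δ ρ α) (aFun lam d δ ρ α)) :
    IsLiftConj ρ (phiFun lam d δ ρ α) (liftF lam d δ a) := by
  have hm := phiFun_strictMono hlam hd hα δ hirr
  have hr := tendsto_phiFun_nhdsGE hlam hd hα δ ρ
  have hp := phiFun_add_int (α := α) hlam hd δ ρ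
  have h0 := inv_zero_of_mem hlam hd hirr hα hδ
  have h1 := inv_threshold_of_mem hlam hd hirr hα ha
  have hmem := inv_threshold_mem hlam hd hirr hα h0 h1
  refine ⟨hm, hr, hp, h0, liftF_strictMono hlam hd hmem δ, fun y n => ?_, fun y => ?_,
    exists_backward_leftCont hlam hd hirr hα δ⟩
  · rw [liftF_eq, liftF_eq, psiFun_add_int]; ring
  · rw [liftF_eq, psiFun_eq_of_inv (gc_lowerInv hm.monotone hr hp) hp hα hmem h0 h1,
      phiFun_add_rot hlam hd]

include hlam hd hirr hα in
theorem tendsto_liftF_of_gap (hδ : δ ∈ Icc (deltaLeft lam d ρ α) (deltaFun lam d ρ α))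
    (ha : a ∈ Icc (aRight lam d δ ρ α) (aFun lam d δ ρ α))
    (hpos : (∃ k ∈ resonances ρ α, 0 < k) → a ≠ aRight lam d δ ρ α)
    (hneg : (∃ k ∈ resonances ρ α, k < 0) → δ ≠ deltaFun lam d ρ α) {x : ℝ}
    (hlt : x < phiFun lam d δ ρ α (lowerInv (phiFun lam d δ ρ α) x))
    (ht : Tendsto (phiFun lam d δ ρ α) (𝓝[<] (lowerInv (phiFun lam d δ ρ α) x)) (𝓝 x)) :
    Tendsto (liftF lam d δ a) (𝓝[<] x) (𝓝 (liftF lam d δ a x)) := by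
  have L := isLiftConj_phiFun hlam hd hirr hα hδ ha
  have h1 := inv_threshold_of_mem hlam hd hirr hα ha
  have hmem := inv_threshold_mem hlam hd hirr hα L.inv_zero h1
  -- translate a gap at `b + n` to the gap at `b`
  have key : ∀ (b : ℝ) (n : ℤ), x = b + n →
      phiLeft lam d δ ρ α (lowerInv (phiFun lam d δ ρ α) b) = b ∧
        b < phiFun lam d δ ρ α (lowerInv (phiFun lam d δ ρ α) b) := by
    rintro b n rfl
    rw [L.inv_add_int] at hlt ht
    rw [L.add_int] at hlt
    refine ⟨?_, by linarith⟩
    have h2 : Tendsto (fun y : ℝ => y + n) (𝓝[<] (lowerInv (phiFun lam d δ ρ α) b))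
        (𝓝[<] (lowerInv (phiFun lam d δ ρ α) b + n)) := by
      simpa using tendsto_sub_const_nhdsLT (-(n : ℝ)) (lowerInv (phiFun lam d δ ρ α) b)
    have h3 := (ht.comp h2).sub_const (n : ℝ)
    simp only [Function.comp_def, L.add_int, add_sub_cancel_right] at h3
    exact tendsto_nhds_unique (tendsto_phiFun_nhdsLT hlam hd hα _ _ _) h3
  refine tendsto_liftF_nhdsLT hmem lam d δ (fun n hn => ?_) fun n hn => ?_
  -- Here φ(0⁻) = 0 < φ(0): the jump provides a negative element of D, while φ(0⁻) = 0 means δ =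
  -- δ(ρ,α).
  · obtain ⟨h2, h3⟩ := key 0 n (by rw [hn, zero_add])
    rw [L.inv_zero] at h2 h3
    have hne : phiLeft lam d δ ρ α 0 ≠ phiFun lam d δ ρ α 0 := by linarith
    refine hneg (not_not.1 fun h => hne (phiLeft_zero_eq hα hirr h)) ?_
    rw [phiLeft_zero hlam hd hα, div_eq_zero_iff] at h2
    rcases h2 with h2 | h2
    · linarith
    · linarith [hlam.2]
  -- Likewise φ(α⁻) = a < φ(α): D has a positive element, while φ(α⁻) = a means a = a(δ,ρ⁺,α).
  · obtain ⟨h2, h3⟩ := key a n (by linarith)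
    rw [h1] at h2 h3
    have hne : phiLeft lam d δ ρ α α ≠ phiFun lam d δ ρ α α := by linarith
    refine hpos (not_not.1 fun h => hne (phiLeft_self_eq hα hirr h)) ?_
    rw [aRight_eq hlam hd hα, h2]

end

end

/-! ### Assembly of the two parts -/

theorem lemmaA5 (lam d : ℝ) (hlam : lam ∈ Set.Ioo (0 : ℝ) 1) (hd : d ∈ Set.Ioo (0 : ℝ) (1 - lam))
    (ρ : ℝ) (hρ : ρ ∈ Set.Ioo (0 : ℝ) 1) (hirr : Irrational ρ)
    (α : ℝ) (hα : α ∈ Set.Icc (0 : ℝ) 1) (δ a : ℝ)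
    (hδ : δ ∈ Set.Icc (deltaLeft lam d ρ α) (deltaFun lam d ρ α))
    (ha : a ∈ Set.Icc (aRight lam d δ ρ α) (aFun lam d δ ρ α)) :
    -- `[φ(0), φ(1⁻))` lies in `[0,1)` and the infimum is over a nonempty set there
    Set.Ico (phiFun lam d δ ρ α 0) (Function.leftLim (phiFun lam d δ ρ α) 1)
        ⊆ Set.Ico (0 : ℝ) 1 ∧
    (∀ x ∈ invDomain (phiFun lam d δ ρ α),
      {y : ℝ | y ∈ Set.Ico (0 : ℝ) 1 ∧ (x : ℝ) ≤ phiFun lam d δ ρ α y}.Nonempty) ∧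
    -- the generalized inverse is continuous for the euclidean and for the circle topology
    ContinuousOn (genInv (phiFun lam d δ ρ α)) (invDomain (phiFun lam d δ ρ α)) ∧
    @ContinuousOn UnitIco UnitIco circleTopology circleTopology
      (genInv (phiFun lam d δ ρ α)) (invDomain (phiFun lam d δ ρ α)) ∧
    -- its restriction to `Λ` is a topological semi-conjugacy, for both topologies
    attractor lam d δ a ⊆ invDomain (phiFun lam d δ ρ α) ∧
    IsTopSemiconjOn instTopologicalSpaceSubtype instTopologicalSpaceSubtype (attractor lam d δ a)
      (mapF lam d δ a) (circleRot ρ) (genInv (phiFun lam d δ ρ α)) ∧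
    IsTopSemiconjOn circleTopology circleTopology (attractor lam d δ a)
      (mapF lam d δ a) (circleRot ρ) (genInv (phiFun lam d δ ρ α)) ∧
    -- extension to the closure of `Λ` in the circle
    (((∃ k ∈ resonances ρ α, 0 < k) → a ≠ aRight lam d δ ρ α) →
      ((∃ k ∈ resonances ρ α, k < 0) → δ ≠ deltaFun lam d ρ α) →
      ∃ h : UnitIco → UnitIco,
        Set.EqOn h (genInv (phiFun lam d δ ρ α)) (attractor lam d δ a) ∧
        IsTopSemiconjOn circleTopology circleTopology
          (@closure UnitIco circleTopology (attractor lam d δ a))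
          (mapF lam d δ a) (circleRot ρ) h) := by
  have L := isLiftConj_phiFun hlam hd hirr hα hδ ha
  have hf : ∀ x, (mapF lam d δ a x : ℝ) = Int.fract (liftF lam d δ a x) := fun _ => rfl
  have hsub : attractor lam d δ a ⊆ invDomain (phiFun lam d δ ρ α) := L.attractor_subset hf
  have heq : EqOn (genInv (phiFun lam d δ ρ α)) (fractInv (phiFun lam d δ ρ α))
      (invDomain (phiFun lam d δ ρ α)) := fun x hx => L.genInv_eq_fractInv hx
  have hcirc : @ContinuousOn UnitIco UnitIco circleTopology circleTopology
      (genInv (phiFun lam d δ ρ α)) (invDomain (phiFun lam d δ ρ α)) :=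
    (@ContinuousOn.congr UnitIco UnitIco circleTopology circleTopology _ _ _
      (@Continuous.continuousOn UnitIco UnitIco circleTopology circleTopology _ _
        L.continuous_fractInv) heq)
  -- The extension is `fractInv`, continuous on the whole circle, so only invariance of the closure
  -- needs the extra hypotheses.
  refine ⟨fun x hx => ?_, fun x hx => ⟨_, L.nonempty_of_mem_invDomain hx⟩, L.continuousOn_genInv,
    hcirc, hsub, ?_, ?_, fun hpos hneg => ⟨fractInv (phiFun lam d δ ρ α), ?_, ?_⟩⟩
  · refine ⟨(phiFun_zero_nonneg hlam hd hα hδ.1).trans hx.1, hx.2.trans_le ?_⟩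
    refine le_of_tendsto (L.strictMono.monotone.tendsto_leftLim 1) ?_
    filter_upwards [Ico_mem_nhdsLT (zero_lt_one (α := ℝ))] with y hy using (L.phi_mem hy).2.le
  · exact L.isTopSemiconjOn_fractInv hf subset_rfl (L.mapsTo_attractor hf) (heq.mono hsub)
      (L.continuousOn_genInv.mono hsub)
  · exact L.isTopSemiconjOn_fractInv hf subset_rfl (L.mapsTo_attractor hf) (heq.mono hsub)
      (@ContinuousOn.mono UnitIco UnitIco circleTopology circleTopology _ _ _ hcirc hsub)
  · exact (heq.mono hsub).symm
  · exact L.isTopSemiconjOn_fractInv hf (@subset_closure UnitIco circleTopology _)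
      (L.mapsTo_closure hf fun x h1 h2 => tendsto_liftF_of_gap hlam hd hirr hα hδ ha hpos hneg h1 h2)
      (fun _ _ => rfl)
      (@Continuous.continuousOn UnitIco UnitIco circleTopology circleTopology _ _
        L.continuous_fractInv)
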